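/- Let $S$ be a finite set of positive integers, let $m=\max S$ and let $k\in S$. An $S$-permutation of $[n]=\{1,\dots,n\}$ is a permutation of $[n]$ all of whose cycle lengths lie in $S$ (fixed points are cycles of length $1$). For every $n$ for which $S$-permutations of $[n]$ exist, let $E_n$ be the expected number of cycles of length $k$ in an $S$-permutation of $[n]$ chosen uniformly at random. Then $S$-permutations of $[n]$ exist for infinitely many $n$, and $$E_n=\frac{n^{k/m}}{k}\,(1+o(1))$$ as $n\to\infty$ through those $n$ for which $S$-permutations of $[n]$ exist. In particular, if the elements of $S$ have greatest common divisor $1$, then $S$-permutations of $[n]$ exist for all sufficiently large $n$, and $E_n=\frac{n^{k/m}}{k}(1+o(1))$ as $n\to\infty$. -/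

import Mathlib

open Filter Topology Asymptotics

/-- The multiset of all cycle lengths of a permutation of `[n]`; every fixed point counts as a
cycle of length `1`. -/
def cycleLengths {n : ℕ} (σ : Equiv.Perm (Fin n)) : Multiset ℕ :=
  σ.partition.parts

/-- The number of `k`-cycles of `σ` (fixed points being the `1`-cycles). -/
def numCycles {n : ℕ} (k : ℕ) (σ : Equiv.Perm (Fin n)) : ℕ :=
  (cycleLengths σ).count k

/-- `σ` is an `S`-permutation: all its cycle lengths lie in `S`. -/
def IsSPermutation (S : Finset ℕ) {n : ℕ} (σ : Equiv.Perm (Fin n)) : Prop :=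
  ∀ l ∈ cycleLengths σ, l ∈ S

instance (S : Finset ℕ) (n : ℕ) :
    DecidablePred (fun σ : Equiv.Perm (Fin n) => IsSPermutation S σ) :=
  fun σ => inferInstanceAs (Decidable (∀ l ∈ cycleLengths σ, l ∈ S))

/-- The finite set of all `S`-permutations of `[n]`. -/
def sPermutations (S : Finset ℕ) (n : ℕ) : Finset (Equiv.Perm (Fin n)) :=
  Finset.univ.filter (fun σ => IsSPermutation S σ)

/-- The expected number of `k`-cycles in an `S`-permutation of `[n]` chosen uniformly at random
(meaningful when `[n]` has an `S`-permutation). -/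
noncomputable def expectedNumCycles (S : Finset ℕ) (k n : ℕ) : ℝ :=
  (∑ σ ∈ sPermutations S n, (numCycles k σ : ℝ)) / ((sPermutations S n).card : ℝ)

/-! Let `a n` be the proportion of `S`-permutations among all permutations of `[n]`. A cycle type
`μ` has density `1 / centralizerOrder μ`, and deleting one `k`-cycle shows that the expected number
of `k`-cycles is `a (n - k) / (k * a n)` (`sum_numCycles`, `expectedNumCycles_eq`). Since the cycle
lengths add up to `n`, the same identity gives `n * a n = ∑ s ∈ S, a (n - s)`, the recurrence for
the coefficients of `exp (∑ z ^ s / s)`. Everything reduces to the ratio `a (n - k) / a n`.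

With `d` the gcd of `S`, `a` lives on multiples of `d`, and `b j = a (d * j)` satisfies the
analogous recurrence with constant `c = 1 / d` and exponents `T = S / d` of gcd `1` and maximum `M`.
Cauchy's formula is applied to `b n` and `b (n - k)` on one common circle, whose radius `r` solves
`c * ∑ r ^ t = n`. At scale `θ = u / r ^ (M / 2)` both integrands tend to the same Gaussian, the
shift by `k` contributing only `exp (i k θ) → 1`. Hence `b (n - k) / b n ~ r ^ k ~ (n / c) ^ (k /
M)` (`coeff_ratio_asymptotics`); all other factors cancel. -/

/-! ### Counting permutations by cycle type -/

/-- The order of the centralizer of a permutation with cycle lengths `μ`. -/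
def centralizerOrder (μ : Multiset ℕ) : ℕ :=
  μ.prod * ∏ i ∈ μ.toFinset, (μ.count i).factorial

theorem centralizerOrder_eq_prod_of_subset {μ : Multiset ℕ} {A : Finset ℕ} (h : μ.toFinset ⊆ A) :
    centralizerOrder μ = μ.prod * ∏ i ∈ A, (μ.count i).factorial := by
  unfold centralizerOrder
  congr 1
  refine Finset.prod_subset h fun i _ hi => ?_
  rw [Multiset.mem_toFinset] at hi
  simp [Multiset.count_eq_zero_of_notMem hi]

theorem centralizerOrder_cons (k : ℕ) (ν : Multiset ℕ) :
    centralizerOrder (k ::ₘ ν) = k * (ν.count k + 1) * centralizerOrder ν := by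
  have hν : ν.toFinset ⊆ (k ::ₘ ν).toFinset := by
    intro i; simp +contextual
  have hk : k ∈ (k ::ₘ ν).toFinset := by simp
  rw [centralizerOrder_eq_prod_of_subset hν, centralizerOrder, Multiset.prod_cons,
    ← Finset.mul_prod_erase _ _ hk, ← Finset.mul_prod_erase _ (fun i => (ν.count i).factorial) hk]
  have : ∏ i ∈ (k ::ₘ ν).toFinset.erase k, ((k ::ₘ ν).count i).factorial
      = ∏ i ∈ (k ::ₘ ν).toFinset.erase k, (ν.count i).factorial := by
    refine Finset.prod_congr rfl fun i hi => ?_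
    rw [Multiset.count_cons_of_ne (Finset.ne_of_mem_erase hi)]
  rw [this, Multiset.count_cons_self, Nat.factorial_succ]
  ring

theorem centralizerOrder_pos {μ : Multiset ℕ} (h : ∀ l ∈ μ, 0 < l) : 0 < centralizerOrder μ :=
  Nat.mul_pos (Multiset.prod_pos h) (Finset.prod_pos fun _ _ => Nat.factorial_pos _)

theorem filter_two_le_add_replicate_one {μ : Multiset ℕ} (h : ∀ l ∈ μ, 0 < l) :
    μ.filter (2 ≤ ·) + Multiset.replicate (μ.count 1) 1 = μ := by
  conv_rhs => rw [← Multiset.filter_add_not (2 ≤ ·) μ]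
  congr 1
  rw [← Multiset.filter_eq']
  refine Multiset.filter_congr fun l hl => ?_
  have := h l hl
  omega

theorem cycleLengths_pos {n : ℕ} (σ : Equiv.Perm (Fin n)) : ∀ l ∈ cycleLengths σ, 0 < l :=
  fun _ hl => σ.partition.parts_pos hl

theorem sum_cycleLengths {n : ℕ} (σ : Equiv.Perm (Fin n)) : (cycleLengths σ).sum = n :=
  σ.partition.parts_sum.trans (Fintype.card_fin n)

/-- `cycleType` omits fixed points, but their number is recovered from the total `n`. -/
theorem cycleLengths_eq_iff {n : ℕ} {μ : Multiset ℕ} (hsum : μ.sum = n) (hpos : ∀ l ∈ μ, 0 < l)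
    (σ : Equiv.Perm (Fin n)) : cycleLengths σ = μ ↔ σ.cycleType = μ.filter (2 ≤ ·) := by
  constructor
  · rintro rfl
    exact Equiv.Perm.filter_parts_partition_eq_cycleType.symm
  · intro h
    have h1 := filter_two_le_add_replicate_one hpos
    have h2 := filter_two_le_add_replicate_one (cycleLengths_pos σ)
    rw [show (cycleLengths σ).filter (2 ≤ ·) = μ.filter (2 ≤ ·) from
      Equiv.Perm.filter_parts_partition_eq_cycleType.trans h] at h2
    have s1 := congrArg Multiset.sum h1
    have s2 := congrArg Multiset.sum h2
    rw [sum_cycleLengths] at s2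
    simp only [Multiset.sum_add, Multiset.sum_replicate, smul_eq_mul, mul_one] at s1 s2
    have : (cycleLengths σ).count 1 = μ.count 1 := by omega
    rw [← h1, ← h2, this]

theorem card_cycleLengths_eq_mul {n : ℕ} {μ : Multiset ℕ} (hsum : μ.sum = n)
    (hpos : ∀ l ∈ μ, 0 < l) :
    (Finset.univ.filter fun σ : Equiv.Perm (Fin n) => cycleLengths σ = μ).card *
      centralizerOrder μ = n.factorial := by
  simp_rw [cycleLengths_eq_iff hsum hpos]
  have h1 := filter_two_le_add_replicate_one hpos
  have s1 := congrArg Multiset.sum h1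
  have p1 := congrArg Multiset.prod h1
  simp only [Multiset.sum_add, Multiset.sum_replicate, smul_eq_mul, mul_one,
    Multiset.prod_add, Multiset.prod_replicate, one_pow] at s1 p1
  -- The factor `(n - sum)!` in this formula counts arrangements of the fixed points; it becomes the
  -- factor of `centralizerOrder` at `i = 1`.
  have key := Equiv.Perm.card_of_cycleType_mul_eq (Fin n) (μ.filter (2 ≤ ·))
  rw [if_pos ⟨by simp; omega, fun a ha => (Multiset.mem_filter.1 ha).2⟩, Fintype.card_fin] at key
  rw [← key]
  congr 1
  have hsub : μ.toFinset ⊆ insert 1 (μ.filter (2 ≤ ·)).toFinset := by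
    intro i hi
    have := hpos i (by simpa using hi)
    simp only [Multiset.toFinset_filter, Finset.mem_insert, Finset.mem_filter]
    by_cases hi1 : i = 1
    · exact Or.inl hi1
    · exact Or.inr ⟨hi, by omega⟩
  rw [centralizerOrder_eq_prod_of_subset hsub, Finset.prod_insert (by simp), p1,
    show n - (μ.filter (2 ≤ ·)).sum = μ.count 1 by omega]
  have : ∏ i ∈ (μ.filter (2 ≤ ·)).toFinset, ((μ.filter (2 ≤ ·)).count i).factorial
      = ∏ i ∈ (μ.filter (2 ≤ ·)).toFinset, (μ.count i).factorial := by
    refine Finset.prod_congr rfl fun i hi => ?_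
    rw [Multiset.count_filter_of_pos]
    simp at hi
    exact hi.2
  rw [this]
  ring

/-! ### Densities of `S`-permutations and their recurrence -/

/-- Adjoining a fixed element to multisets, as an embedding. -/
def Multiset.consEmbedding {α : Type*} (a : α) : Multiset α ↪ Multiset α where
  toFun := Multiset.cons a
  inj' := fun _ _ h => (Multiset.cons_inj_right a).1 h

theorem Multiset.consEmbedding_apply {α : Type*} (a : α) (s : Multiset α) :
    Multiset.consEmbedding a s = a ::ₘ s := rfl

/-- The multisets with sum `n` and all elements positive and in `S`. -/
def partitionsIn (S : Finset ℕ) (n : ℕ) : Finset (Multiset ℕ) :=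
  ((Finset.univ : Finset n.Partition).image Nat.Partition.parts).filter fun μ => ∀ l ∈ μ, l ∈ S

theorem mem_partitionsIn {S : Finset ℕ} (hS : ∀ s ∈ S, 0 < s) {n : ℕ} {μ : Multiset ℕ} :
    μ ∈ partitionsIn S n ↔ μ.sum = n ∧ ∀ l ∈ μ, l ∈ S := by
  simp only [partitionsIn, Finset.mem_filter, Finset.mem_image, Finset.mem_univ, true_and]
  constructor
  · rintro ⟨⟨p, rfl⟩, h⟩
    exact ⟨p.parts_sum, h⟩
  · rintro ⟨hs, h⟩
    exact ⟨⟨⟨μ, fun hi => hS _ (h _ hi), hs⟩, rfl⟩, h⟩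

theorem sum_sPermutations_comp_cycleLengths {S : Finset ℕ} (hS : ∀ s ∈ S, 0 < s) (n : ℕ)
    (f : Multiset ℕ → ℝ) :
    ∑ σ ∈ sPermutations S n, f (cycleLengths σ)
      = n.factorial * ∑ μ ∈ partitionsIn S n, f μ / centralizerOrder μ := by
  have hmaps : ∀ σ ∈ sPermutations S n, cycleLengths σ ∈ partitionsIn S n := by
    intro σ hσ
    rw [mem_partitionsIn hS]
    exact ⟨sum_cycleLengths σ, (Finset.mem_filter.1 hσ).2⟩
  rw [← Finset.sum_fiberwise_of_maps_to hmaps, Finset.mul_sum]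
  refine Finset.sum_congr rfl fun μ hμ => ?_
  rw [mem_partitionsIn hS] at hμ
  have hpos : ∀ l ∈ μ, 0 < l := fun l hl => hS l (hμ.2 l hl)
  have hfib : (sPermutations S n).filter (fun σ => cycleLengths σ = μ)
      = Finset.univ.filter fun σ : Equiv.Perm (Fin n) => cycleLengths σ = μ := by
    ext σ
    simp only [sPermutations, IsSPermutation, Finset.mem_filter, Finset.mem_univ, true_and]
    constructor
    · exact fun h => h.2
    · rintro rfl
      exact ⟨Finset.mem_filter.2 ⟨Finset.mem_univ _, hμ.2⟩, rfl⟩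
  rw [Finset.sum_congr rfl (g := fun _ => f μ) (fun σ hσ => by rw [(Finset.mem_filter.1 hσ).2]),
    Finset.sum_const, hfib, ← card_cycleLengths_eq_mul hμ.1 hpos]
  have : (centralizerOrder μ : ℝ) ≠ 0 := by exact_mod_cast (centralizerOrder_pos hpos).ne'
  push_cast
  rw [nsmul_eq_mul]
  field_simp

/-- The proportion of `S`-permutations among all permutations of `[n]`. -/
noncomputable def sPermutationDensity (S : Finset ℕ) (n : ℕ) : ℝ :=
  (sPermutations S n).card / n.factorial

theorem sPermutationDensity_eq_sum {S : Finset ℕ} (hS : ∀ s ∈ S, 0 < s) (n : ℕ) :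
    sPermutationDensity S n = ∑ μ ∈ partitionsIn S n, 1 / (centralizerOrder μ : ℝ) := by
  have h := sum_sPermutations_comp_cycleLengths hS n fun _ => 1
  have hn : (n.factorial : ℝ) ≠ 0 := by exact_mod_cast n.factorial_ne_zero
  rw [Finset.sum_const, nsmul_eq_mul, mul_one] at h
  rw [sPermutationDensity, h]
  field_simp

/-- Adjoining `k` is a bijection from the partitions of `n - k` onto those of `n` containing `k`; by
`centralizerOrder_cons` the weight `k * count k` cancels exactly the factor gained. Partitions
without `k` contribute nothing. -/
theorem sum_numCycles {S : Finset ℕ} (hS : ∀ s ∈ S, 0 < s) {k : ℕ} (hk : k ∈ S) (n : ℕ) :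
    k * ∑ σ ∈ sPermutations S n, (numCycles k σ : ℝ)
      = n.factorial * if k ≤ n then sPermutationDensity S (n - k) else 0 := by
  have h := sum_sPermutations_comp_cycleLengths hS n fun μ => (μ.count k : ℝ)
  unfold numCycles
  rw [h, mul_left_comm]
  congr 1
  rw [Finset.mul_sum]
  split_ifs with hkn
  · rw [sPermutationDensity_eq_sum hS]
    symm
    have hsub : (partitionsIn S (n - k)).map (Multiset.consEmbedding k)
        ⊆ partitionsIn S n := by
      intro μ hμ
      obtain ⟨ν, hν, rfl⟩ := Finset.mem_map.1 hμ
      rw [mem_partitionsIn hS] at hν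
      rw [mem_partitionsIn hS]
      simp only [Multiset.consEmbedding_apply, Multiset.sum_cons, Multiset.mem_cons,
        forall_eq_or_imp]
      exact ⟨by omega, hk, hν.2⟩
    rw [← Finset.sum_subset hsub, Finset.sum_map]
    · refine Finset.sum_congr rfl fun ν hν => ?_
      rw [mem_partitionsIn hS] at hν
      have h1 : (centralizerOrder ν : ℝ) ≠ 0 := by
        exact_mod_cast (centralizerOrder_pos fun l hl => hS l (hν.2 l hl)).ne'
      have h2 : (k : ℝ) ≠ 0 := by exact_mod_cast (hS k hk).ne'
      have h3 : (ν.count k : ℝ) + 1 ≠ 0 := by positivity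
      simp only [Multiset.consEmbedding_apply, Multiset.count_cons_self, centralizerOrder_cons]
      push_cast
      field_simp
    · intro μ hμ hμ'
      rw [mem_partitionsIn hS] at hμ
      have : k ∉ μ := by
        intro hkμ
        refine hμ' (Finset.mem_map.2 ⟨μ.erase k, ?_, Multiset.cons_erase hkμ⟩)
        rw [mem_partitionsIn hS]
        refine ⟨?_, fun l hl => hμ.2 l (Multiset.mem_of_mem_erase hl)⟩
        have := congrArg Multiset.sum (Multiset.cons_erase hkμ)
        rw [Multiset.sum_cons] at this
        omega
      simp [Multiset.count_eq_zero_of_notMem this]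
  · refine Finset.sum_eq_zero fun μ hμ => ?_
    rw [mem_partitionsIn hS] at hμ
    have : k ∉ μ := fun h => hkn (hμ.1 ▸ Multiset.le_sum_of_mem h)
    simp [Multiset.count_eq_zero_of_notMem this]

/-- Sum `sum_numCycles` over `S` and use that the cycle lengths of each permutation add up to `n`.
-/
theorem sPermutationDensity_recurrence {S : Finset ℕ} (hS : ∀ s ∈ S, 0 < s) (n : ℕ) :
    n * sPermutationDensity S n
      = ∑ s ∈ S, if s ≤ n then sPermutationDensity S (n - s) else 0 := by
  have hn : (n.factorial : ℝ) ≠ 0 := by exact_mod_cast n.factorial_ne_zero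
  apply mul_left_cancel₀ hn
  rw [Finset.mul_sum, ← Finset.sum_congr rfl fun s hs => sum_numCycles hS hs n]
  simp_rw [Finset.mul_sum]
  rw [Finset.sum_comm]
  have : ∀ σ ∈ sPermutations S n, ∑ s ∈ S, (s : ℝ) * (numCycles s σ : ℝ) = n := by
    intro σ hσ
    have h := Finset.sum_multiset_count_of_subset (cycleLengths σ) S
      fun l hl => (Finset.mem_filter.1 hσ).2 l (Multiset.mem_toFinset.1 hl)
    rw [sum_cycleLengths] at h
    conv_rhs => rw [h]
    push_cast
    exact Finset.sum_congr rfl fun s _ => by simp [numCycles, mul_comm]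
  rw [Finset.sum_congr rfl this, Finset.sum_const, sPermutationDensity, nsmul_eq_mul]
  field_simp

theorem sPermutationDensity_zero (S : Finset ℕ) : sPermutationDensity S 0 = 1 := by
  have : sPermutations S 0 = {1} := by
    ext σ
    simp [sPermutations, IsSPermutation, Subsingleton.elim σ 1, cycleLengths,
      Equiv.Perm.parts_partition]
  simp [sPermutationDensity, this]

theorem sPermutationDensity_pos_iff {S : Finset ℕ} {n : ℕ} :
    0 < sPermutationDensity S n ↔ (sPermutations S n).Nonempty := by
  rw [sPermutationDensity, div_pos_iff_of_pos_right (by exact_mod_cast n.factorial_pos),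
    Nat.cast_pos, Finset.card_pos]

theorem gcd_dvd_of_sPermutations_nonempty {S : Finset ℕ} {n : ℕ}
    (h : (sPermutations S n).Nonempty) : S.gcd id ∣ n := by
  obtain ⟨σ, hσ⟩ := h
  rw [← sum_cycleLengths σ]
  exact Multiset.dvd_sum fun l hl => Finset.gcd_dvd ((Finset.mem_filter.1 hσ).2 l hl)

theorem expectedNumCycles_eq {S : Finset ℕ} (hS : ∀ s ∈ S, 0 < s) {k : ℕ} (hk : k ∈ S) {n : ℕ}
    (hkn : k ≤ n) :
    expectedNumCycles S k n = sPermutationDensity S (n - k) / sPermutationDensity S n / k := by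
  have hn : (n.factorial : ℝ) ≠ 0 := by exact_mod_cast n.factorial_ne_zero
  have hk0 : (k : ℝ) ≠ 0 := by exact_mod_cast (hS k hk).ne'
  have h := sum_numCycles hS hk n
  rw [if_pos hkn] at h
  rw [expectedNumCycles, eq_div_iff hk0, div_mul_eq_mul_div, mul_comm _ (k : ℝ), h,
    sPermutationDensity.eq_def S n, div_div_eq_mul_div, mul_comm]

/-! ### Coefficients as contour integrals -/

/-- The polynomial `c ∑ z ^ t / t` over `t ∈ T`, the logarithm of the generating function. -/
noncomputable def cyclePoly (c : ℝ) (T : Finset ℕ) (z : ℂ) : ℂ :=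
  c * ∑ t ∈ T, z ^ t / t

theorem hasDerivAt_cyclePoly (c : ℝ) {T : Finset ℕ} (hT : ∀ t ∈ T, 0 < t) (z : ℂ) :
    HasDerivAt (cyclePoly c T) (c * ∑ t ∈ T, z ^ (t - 1)) z := by
  refine (HasDerivAt.fun_sum fun t ht => ?_).const_mul (c : ℂ)
  have h := (hasDerivAt_pow t z).div_const (t : ℂ)
  have : (t : ℂ) ≠ 0 := by exact_mod_cast (hT t ht).ne'
  rwa [mul_div_cancel_left₀ _ this] at h

theorem differentiable_exp_cyclePoly (c : ℝ) {T : Finset ℕ} (hT : ∀ t ∈ T, 0 < t) :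
    Differentiable ℂ fun z => Complex.exp (cyclePoly c T z) :=
  fun z => (hasDerivAt_cyclePoly c hT z).differentiableAt.cexp

theorem circleIntegrable_exp_cyclePoly_mul_zpow (c : ℝ) {T : Finset ℕ} (hT : ∀ t ∈ T, 0 < t)
    {r : ℝ} (hr : 0 < r) (n : ℤ) :
    CircleIntegrable (fun z => Complex.exp (cyclePoly c T z) * z ^ n) 0 r := by
  refine ContinuousOn.circleIntegrable hr.le ?_
  refine (differentiable_exp_cyclePoly c hT).continuous.continuousOn.mul
    (continuousOn_id.zpow₀ n fun z hz => Or.inl ?_)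
  rintro rfl
  simp [hr.ne] at hz

/-- The derivative of `exp (cyclePoly c T z) * z ^ (-n)` integrates to zero around the circle. -/
theorem circleIntegral_exp_cyclePoly_recurrence (c : ℝ) {T : Finset ℕ} (hT : ∀ t ∈ T, 0 < t)
    {r : ℝ} (hr : 0 < r) (n : ℤ) :
    n * (∮ z in C(0, r), Complex.exp (cyclePoly c T z) * z ^ (-n - 1))
      = c * ∑ t ∈ T, ∮ z in C(0, r), Complex.exp (cyclePoly c T z) * z ^ (-(n - t) - 1) := by
  have hint := fun m => circleIntegrable_exp_cyclePoly_mul_zpow c hT hr m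
  have h0 : (∮ z in C(0, r), (c * ∑ t ∈ T, Complex.exp (cyclePoly c T z) * z ^ (-(n - t) - 1)
      - n * (Complex.exp (cyclePoly c T z) * z ^ (-n - 1)))) = 0 := by
    refine circleIntegral.integral_eq_zero_of_hasDerivWithinAt
      (f := fun z => Complex.exp (cyclePoly c T z) * z ^ (-n)) hr.le fun z hz => ?_
    have hz0 : z ≠ 0 := by
      rintro rfl
      simp [hr.ne] at hz
    have h := ((hasDerivAt_cyclePoly c hT z).cexp.mul (hasDerivAt_zpow (-n) z (Or.inl hz0)))
    refine (h.congr_deriv ?_).hasDerivWithinAt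
    rw [mul_assoc, mul_assoc, Finset.sum_mul, mul_left_comm, Finset.mul_sum]
    have : ∀ t ∈ T, Complex.exp (cyclePoly c T z) * (z ^ (t - 1) * z ^ (-n))
        = Complex.exp (cyclePoly c T z) * z ^ (-(n - t) - 1) := by
      intro t ht
      rw [← zpow_natCast, ← zpow_add₀ hz0]
      congr 2
      have := hT t ht
      push_cast [Nat.cast_sub this]
      ring
    rw [Finset.sum_congr rfl this]
    push_cast
    ring
  rw [circleIntegral.integral_sub, circleIntegral.integral_const_mul,
    circleIntegral.integral_const_mul, circleIntegral.integral_fun_sum] at h0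
  · exact (sub_eq_zero.1 h0).symm
  · exact fun t _ => hint _
  · exact (CircleIntegrable.fun_sum _ fun t _ => hint _).const_fun_smul (a := (c : ℂ))
  · exact (hint _).const_fun_smul (a := (n : ℂ))

theorem circleIntegral_exp_cyclePoly_of_neg (c : ℝ) {T : Finset ℕ} (hT : ∀ t ∈ T, 0 < t)
    {r : ℝ} (hr : 0 < r) {n : ℤ} (hn : n < 0) :
    (∮ z in C(0, r), Complex.exp (cyclePoly c T z) * z ^ (-n - 1)) = 0 := by
  obtain ⟨k, hk⟩ := Int.eq_ofNat_of_zero_le (show 0 ≤ -n - 1 by omega)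
  simp_rw [hk]
  have hd : Differentiable ℂ fun z => Complex.exp (cyclePoly c T z) * z ^ (k : ℤ) := by
    simp_rw [zpow_natCast]
    exact (differentiable_exp_cyclePoly c hT).mul (differentiable_id.pow k)
  exact hd.diffContOnCl.circleIntegral_eq_zero hr.le

theorem circleIntegral_exp_cyclePoly_zero (c : ℝ) {T : Finset ℕ} (hT : ∀ t ∈ T, 0 < t)
    {r : ℝ} (hr : 0 < r) :
    (∮ z in C(0, r), Complex.exp (cyclePoly c T z) * z ^ (-(0 : ℤ) - 1))
      = 2 * Real.pi * Complex.I := by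
  have h := (differentiable_exp_cyclePoly c hT).differentiableOn.circleIntegral_sub_inv_smul
    (R := r) (c := 0) (w := 0) (by simpa using hr)
  have h0 : cyclePoly c T 0 = 0 := by
    simp only [cyclePoly]
    rw [Finset.sum_eq_zero, mul_zero]
    intro t ht
    rw [zero_pow (hT t ht).ne', zero_div]
  rw [h0] at h
  simpa [mul_comm] using h

/-- Both sides obey the same recurrence with the same initial value, so no power series expansion is
needed. -/
theorem circleIntegral_exp_cyclePoly_eq (c : ℝ) {T : Finset ℕ} (hT : ∀ t ∈ T, 0 < t)
    {b : ℕ → ℝ} (hb0 : b 0 = 1)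
    (hb : ∀ n : ℕ, n * b n = c * ∑ t ∈ T, if t ≤ n then b (n - t) else 0)
    {r : ℝ} (hr : 0 < r) (n : ℕ) :
    (∮ z in C(0, r), Complex.exp (cyclePoly c T z) * z ^ (-(n : ℤ) - 1))
      = 2 * Real.pi * Complex.I * b n := by
  induction n using Nat.strong_induction_on with
  | _ n ih =>
  rcases Nat.eq_zero_or_pos n with rfl | hn
  · rw [hb0]
    simpa using circleIntegral_exp_cyclePoly_zero c hT hr
  have hn0 : (n : ℂ) ≠ 0 := by exact_mod_cast hn.ne'
  apply mul_left_cancel₀ hn0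
  have hrec := circleIntegral_exp_cyclePoly_recurrence c hT hr n
  rw [Int.cast_natCast] at hrec
  have hbn : (n : ℂ) * b n = c * ∑ t ∈ T, ((if t ≤ n then b (n - t) else 0 : ℝ) : ℂ) := by
    exact_mod_cast congrArg (fun x : ℝ => (x : ℂ)) (hb n)
  rw [hrec, mul_left_comm, hbn, mul_left_comm, Finset.mul_sum T _ (2 * Real.pi * Complex.I)]
  congr 1
  refine Finset.sum_congr rfl fun t ht => ?_
  split_ifs with htn
  · rw [← ih (n - t) (by have := hT t ht; omega), Nat.cast_sub htn]
  · rw [circleIntegral_exp_cyclePoly_of_neg c hT hr (by omega)]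
    simp

/-! ### The integral at the saddle point -/

/-- The exponent `c ∑ r ^ t / t * (exp (i t θ) - 1 - i t θ)` of the saddle point integrand. -/
noncomputable def saddleExponent (c : ℝ) (T : Finset ℕ) (r θ : ℝ) : ℂ :=
  ∑ t ∈ T, ((c * r ^ t / t : ℝ) : ℂ) *
    (Complex.exp (Complex.I * (t * θ : ℝ)) - 1 - Complex.I * (t * θ : ℝ))

theorem continuous_saddleExponent (c : ℝ) (T : Finset ℕ) (r : ℝ) :
    Continuous (saddleExponent c T r) := by
  unfold saddleExponent
  fun_prop

/-- Coefficients as saddle point integrals, when the radius satisfies the saddle point equation. -/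
theorem coeff_eq_saddle_integral (c : ℝ) {T : Finset ℕ} (hT : ∀ t ∈ T, 0 < t)
    {b : ℕ → ℝ} (hb0 : b 0 = 1)
    (hb : ∀ n : ℕ, n * b n = c * ∑ t ∈ T, if t ≤ n then b (n - t) else 0)
    {r : ℝ} (hr : 0 < r) {n k : ℕ} (hk : k ≤ n) (hrn : c * ∑ t ∈ T, r ^ t = n) :
    ∫ θ in (-Real.pi)..Real.pi,
        Complex.exp (saddleExponent c T r θ) * Complex.exp (Complex.I * (k * θ : ℝ))
      = ((2 * Real.pi * Real.exp (-(c * ∑ t ∈ T, r ^ t / t)) * r ^ (n - k) * b (n - k) : ℝ) : ℂ) := by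
  have h := circleIntegral_exp_cyclePoly_eq c hT hb0 hb hr (n - k)
  have hrC : (r : ℂ) ≠ 0 := by exact_mod_cast hr.ne'
  set E : ℂ := Complex.exp (c * ∑ t ∈ T, (r : ℂ) ^ t / t) with hE
  have hE0 : E ≠ 0 := Complex.exp_ne_zero _
  have hper : ∀ θ : ℝ, deriv (circleMap 0 r) θ • (Complex.exp (cyclePoly c T (circleMap 0 r θ)) *
      circleMap 0 r θ ^ (-((n - k : ℕ) : ℤ) - 1)) = Complex.I * E * ((r : ℂ) ^ (n - k))⁻¹ *
      (Complex.exp (saddleExponent c T r θ) * Complex.exp (Complex.I * (k * θ : ℝ))) := by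
    intro θ
    have hz0 : circleMap 0 r θ ≠ 0 := circleMap_ne_center hr.ne'
    have hz : circleMap 0 r θ = r * Complex.exp (θ * Complex.I) := by simp [circleMap]
    have e1 : circleMap 0 r θ * circleMap 0 r θ ^ (-((n - k : ℕ) : ℤ) - 1)
        = ((r : ℂ) ^ (n - k))⁻¹ * Complex.exp (-(((n - k : ℕ) : ℂ) * (θ * Complex.I))) := by
      rw [← zpow_one_add₀ hz0, show (1 + (-((n - k : ℕ) : ℤ) - 1)) = -((n - k : ℕ) : ℤ) by ring,
        zpow_neg, zpow_natCast, hz, mul_pow, mul_inv, ← Complex.exp_nat_mul, ← Complex.exp_neg]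
    have e2 : Complex.exp (cyclePoly c T (circleMap 0 r θ)) *
        Complex.exp (-(((n - k : ℕ) : ℂ) * (θ * Complex.I)))
        = E * (Complex.exp (saddleExponent c T r θ) * Complex.exp (Complex.I * (k * θ : ℝ))) := by
      rw [hE, ← Complex.exp_add, ← Complex.exp_add, ← Complex.exp_add]
      congr 1
      have hrnC : (c : ℂ) * ∑ t ∈ T, (r : ℂ) ^ t = n := by
        exact_mod_cast congrArg (fun x : ℝ => (x : ℂ)) hrn
      -- By the saddle point equation the term linear in `θ` is `i n θ`; against `exp (-i (n - k)
      -- θ)` only `exp (i k θ)` remains.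
      have hsum : cyclePoly c T (circleMap 0 r θ) = c * ∑ t ∈ T, (r : ℂ) ^ t / t
          + saddleExponent c T r θ + Complex.I * θ * (c * ∑ t ∈ T, (r : ℂ) ^ t) := by
        simp only [cyclePoly, saddleExponent, Finset.mul_sum, ← Finset.sum_add_distrib]
        refine Finset.sum_congr rfl fun t ht => ?_
        have ht0 : (t : ℂ) ≠ 0 := by exact_mod_cast (hT t ht).ne'
        rw [hz, mul_pow, ← Complex.exp_nat_mul,
          show (t : ℂ) * (θ * Complex.I) = Complex.I * (t * θ : ℝ) by push_cast; ring]
        push_cast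
        field_simp
        ring
      rw [hsum, hrnC, Nat.cast_sub hk]
      push_cast
      ring
    rw [deriv_circleMap, smul_eq_mul]
    linear_combination (Complex.I * Complex.exp (cyclePoly c T (circleMap 0 r θ))) * e1 +
      (Complex.I * ((r : ℂ) ^ (n - k))⁻¹) * e2
  have hshift : ∫ θ in (0 : ℝ)..2 * Real.pi, deriv (circleMap 0 r) θ •
      (Complex.exp (cyclePoly c T (circleMap 0 r θ)) *
        circleMap 0 r θ ^ (-((n - k : ℕ) : ℤ) - 1))
      = ∫ θ in (-Real.pi)..Real.pi, deriv (circleMap 0 r) θ •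
      (Complex.exp (cyclePoly c T (circleMap 0 r θ)) *
        circleMap 0 r θ ^ (-((n - k : ℕ) : ℤ) - 1)) := by
    have hp : Function.Periodic (fun θ : ℝ => deriv (circleMap 0 r) θ •
      (Complex.exp (cyclePoly c T (circleMap 0 r θ)) *
        circleMap 0 r θ ^ (-((n - k : ℕ) : ℤ) - 1))) (2 * Real.pi) := by
      intro θ
      simp only [deriv_circleMap, periodic_circleMap 0 r θ]
    have := hp.intervalIntegral_add_eq 0 (-Real.pi)
    rwa [zero_add, show -Real.pi + 2 * Real.pi = Real.pi by ring] at this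
  rw [circleIntegral, hshift, intervalIntegral.integral_congr (fun θ _ => hper θ),
    intervalIntegral.integral_const_mul] at h
  have hE' : ((Real.exp (-(c * ∑ t ∈ T, r ^ t / t)) : ℝ) : ℂ) = E⁻¹ := by
    rw [hE, ← Complex.exp_neg]
    push_cast
    rfl
  generalize (∫ θ in (-Real.pi)..Real.pi,
    Complex.exp (saddleExponent c T r θ) * Complex.exp (Complex.I * (k * θ : ℝ))) = J at h ⊢
  simp only [Complex.ofReal_mul, Complex.ofReal_pow, Complex.ofReal_ofNat]
  rw [hE']
  have hrk : (r : ℂ) ^ (n - k) ≠ 0 := pow_ne_zero _ hrC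
  field_simp at h ⊢
  linear_combination h

/-! ### Pointwise convergence to a Gaussian -/

theorem tendsto_mul_exp_sub_one_sub_id {ι : Type*} {l : Filter ι} {w θ : ι → ℝ} {L : ℝ} (t : ℕ)
    (hθ : Tendsto θ l (𝓝 0)) (hw : Tendsto (fun i => w i * θ i ^ 2) l (𝓝 L)) :
    Tendsto (fun i => (w i : ℂ) *
        (Complex.exp (Complex.I * (t * θ i : ℝ)) - 1 - Complex.I * (t * θ i : ℝ))) l
      (𝓝 ((-(t ^ 2 / 2 * L) : ℝ) : ℂ)) := by
  have hmain : Tendsto (fun i => ((-(t ^ 2 / 2 * (w i * θ i ^ 2)) : ℝ) : ℂ)) l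
      (𝓝 ((-(t ^ 2 / 2 * L) : ℝ) : ℂ)) :=
    (Complex.continuous_ofReal.tendsto _).comp (hw.const_mul _).neg
  -- The cubic Taylor remainder, with one factor `|θ|` left over after `w * θ ^ 2` is split off.
  have hbound : Tendsto (fun i => |w i * θ i ^ 2| * (t ^ 3 * |θ i|)) l (𝓝 0) := by
    simpa using hw.abs.mul (hθ.abs.const_mul ((t : ℝ) ^ 3))
  have hsmall : ∀ᶠ i in l, |t * θ i| ≤ 1 := by
    have : Tendsto (fun i => |t * θ i|) l (𝓝 0) := by simpa using (hθ.const_mul (t : ℝ)).abs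
    exact (this.eventually (gt_mem_nhds one_pos)).mono fun _ h => h.le
  have hdiff : Tendsto (fun i => (w i : ℂ) *
        (Complex.exp (Complex.I * (t * θ i : ℝ)) - 1 - Complex.I * (t * θ i : ℝ))
        - ((-(t ^ 2 / 2 * (w i * θ i ^ 2)) : ℝ) : ℂ)) l (𝓝 0) := by
    refine squeeze_zero_norm' (hsmall.mono fun i hi => ?_) hbound
    set x : ℝ := t * θ i with hx
    have hnorm : ‖Complex.I * (x : ℂ)‖ = |x| := by simp
    have h3 := Complex.exp_bound (x := Complex.I * x) (by rw [hnorm]; exact hi)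
      (n := 3) (by norm_num)
    rw [hnorm] at h3
    have hs : (w i : ℂ) * (Complex.exp (Complex.I * x) - 1 - Complex.I * x)
        - ((-(t ^ 2 / 2 * (w i * θ i ^ 2)) : ℝ) : ℂ)
        = w i * (Complex.exp (Complex.I * x)
          - ∑ m ∈ Finset.range 3, (Complex.I * x) ^ m / m.factorial) := by
      simp only [Finset.sum_range_succ, Finset.sum_range_zero, hx, mul_pow, Complex.I_sq]
      push_cast
      simp
      ring
    rw [hs, norm_mul, Complex.norm_real, Real.norm_eq_abs]
    have h4 : |x| ^ 3 * ((Nat.succ 3 : ℝ) * ((Nat.factorial 3 : ℝ) * (3 : ℕ))⁻¹) ≤ |x| ^ 3 := by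
      refine mul_le_of_le_one_right (by positivity) ?_
      norm_num [Nat.factorial]
    calc |w i| * ‖_‖ ≤ |w i| * |x| ^ 3 := by
          gcongr
          exact h3.trans h4
      _ = |w i * θ i ^ 2| * (t ^ 3 * |θ i|) := by
          rw [hx, abs_mul, abs_mul, abs_pow, Nat.abs_cast]
          ring
  simpa using hdiff.add hmain

/-- Here `r = ρ ^ 2`, so that `r ^ (M / 2)` is the natural power `ρ ^ M`. The quadratic part of term
`t` has size `ρ ^ (2 * (t - M))`, so only `t = M` survives. -/
theorem tendsto_saddleExponent {c : ℝ} {T : Finset ℕ} (hT : ∀ t ∈ T, 0 < t) {M : ℕ}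
    (hM : IsGreatest (T : Set ℕ) M) (u : ℝ) :
    Tendsto (fun ρ : ℝ => saddleExponent c T (ρ ^ 2) (u / ρ ^ M)) atTop
      (𝓝 ((-(c * M / 2) * u ^ 2 : ℝ) : ℂ)) := by
  have hM0 : 0 < M := hT M hM.1
  have hθ : Tendsto (fun ρ : ℝ => u / ρ ^ M) atTop (𝓝 0) :=
    tendsto_const_nhds.div_atTop (tendsto_pow_atTop hM0.ne')
  have hlim : (((-(c * M / 2) * u ^ 2 : ℝ)) : ℂ)
      = ∑ t ∈ T, ((-((t : ℝ) ^ 2 / 2 * (if t = M then c / t * u ^ 2 else 0)) : ℝ) : ℂ) := by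
    rw [← Complex.ofReal_sum, Finset.sum_eq_single_of_mem M hM.1, if_pos rfl]
    · congr 1
      have : (M : ℝ) ≠ 0 := by exact_mod_cast hM0.ne'
      field_simp
    · intro t _ ht
      simp [ht]
  rw [hlim]
  refine tendsto_finsetSum _ fun t ht => tendsto_mul_exp_sub_one_sub_id t hθ ?_
  have hev : (fun ρ : ℝ => c * (ρ ^ 2) ^ t / t * (u / ρ ^ M) ^ 2) =ᶠ[atTop]
      fun ρ => c / t * u ^ 2 * (1 / ρ ^ (2 * (M - t))) := by
    filter_upwards [eventually_gt_atTop 0] with ρ hρ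
    have htM : t ≤ M := hM.2 ht
    obtain ⟨e, rfl⟩ := Nat.exists_eq_add_of_le htM
    have h2 : (t : ℝ) ≠ 0 := by exact_mod_cast (hT t ht).ne'
    rw [Nat.add_sub_cancel_left]
    field_simp
    ring
  rw [tendsto_congr' hev]
  split_ifs with h
  · subst h
    simp
  · rw [show (0 : ℝ) = c / t * u ^ 2 * 0 by ring]
    refine Tendsto.const_mul _ (tendsto_const_nhds.div_atTop (tendsto_pow_atTop ?_))
    have := hM.2 ht
    omega

/-! ### Uniform domination of the integrand -/

/-- Each `t * θ` is a multiple of `2π`; by Bézout so is `θ`. -/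
theorem eq_zero_of_forall_cos_eq_one {T : Finset ℕ} (hgcd : T.gcd id = 1) {θ : ℝ}
    (hθ : |θ| ≤ Real.pi) (h : ∀ t ∈ T, Real.cos (t * θ) = 1) : θ = 0 := by
  have hk : ∀ t ∈ T, ∃ j : ℤ, (j : ℝ) * (2 * Real.pi) = t * θ := fun t ht =>
    (Real.cos_eq_one_iff _).1 (h t ht)
  choose! j hj using hk
  have hgcdZ : T.gcd (fun t : ℕ => (t : ℤ)) = 1 := by
    have h1 : T.gcd (fun t : ℕ => (t : ℤ)) ∣ 1 := by
      have h2 : (T.gcd (fun t : ℕ => (t : ℤ))).natAbs ∣ T.gcd id :=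
        Finset.dvd_gcd fun t ht => Int.natCast_dvd_natCast.1
          (Int.natAbs_dvd.2 (Finset.gcd_dvd (f := fun t : ℕ => (t : ℤ)) ht))
      rw [hgcd] at h2
      exact Int.natAbs_dvd_natAbs.1 (by simpa using h2)
    rw [← Finset.normalize_gcd]
    exact normalize_eq_one.2 (isUnit_of_dvd_one h1)
  obtain ⟨f, hf⟩ := Finset.gcd_eq_sum_mul T (fun t : ℕ => (t : ℤ))
  rw [hgcdZ] at hf
  have hsum : θ = ((∑ t ∈ T, j t * f t : ℤ) : ℝ) * (2 * Real.pi) := by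
    have hf' : (1 : ℝ) = ∑ t ∈ T, (t : ℝ) * f t := by exact_mod_cast hf
    calc θ = (∑ t ∈ T, (t : ℝ) * f t) * θ := by rw [← hf', one_mul]
      _ = _ := by
        push_cast
        rw [Finset.sum_mul, Finset.sum_mul]
        refine Finset.sum_congr rfl fun t ht => ?_
        linear_combination (-(f t : ℝ)) * hj t ht
  set N : ℤ := ∑ t ∈ T, j t * f t
  have hN : N = 0 := by
    by_contra hne
    have h1 : (1 : ℝ) ≤ |(N : ℝ)| := by exact_mod_cast Int.one_le_abs hne
    rw [hsum, abs_mul, abs_of_pos Real.two_pi_pos] at hθ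
    nlinarith [Real.pi_pos]
  rw [hsum, hN]
  simp

theorem exists_pos_le_sum_one_sub_cos {T : Finset ℕ} (hT : ∀ t ∈ T, 0 < t)
    (hgcd : T.gcd id = 1) {ε : ℝ} (hε : 0 < ε) (hε' : ε ≤ Real.pi) :
    ∃ δ > 0, ∀ θ : ℝ, ε ≤ |θ| → |θ| ≤ Real.pi → δ ≤ ∑ t ∈ T, (1 - Real.cos (t * θ)) / t := by
  have hK : IsCompact {θ : ℝ | ε ≤ |θ| ∧ |θ| ≤ Real.pi} := by
    refine Metric.isCompact_of_isClosed_isBounded ?_ ?_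
    · exact (isClosed_le continuous_const continuous_abs).inter
        (isClosed_le continuous_abs continuous_const)
    · exact (Metric.isBounded_Icc (-Real.pi) Real.pi).subset fun θ hθ => abs_le.1 hθ.2
  have hne : {θ : ℝ | ε ≤ |θ| ∧ |θ| ≤ Real.pi}.Nonempty :=
    ⟨Real.pi, by simp [abs_of_pos Real.pi_pos, hε']⟩
  obtain ⟨θ₀, hθ₀, hmin⟩ := hK.exists_isMinOn hne
    (f := fun θ : ℝ => ∑ t ∈ T, (1 - Real.cos (t * θ)) / t) (by fun_prop)
  have hnn : ∀ t ∈ T, 0 ≤ (1 - Real.cos (t * θ₀)) / (t : ℝ) := fun t _ =>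
    div_nonneg (sub_nonneg.2 (Real.cos_le_one _)) (Nat.cast_nonneg t)
  refine ⟨_, ?_, fun θ h1 h2 => hmin ⟨h1, h2⟩⟩
  refine (Finset.sum_nonneg hnn).lt_of_ne' fun h0 => ?_
  have : θ₀ = 0 := by
    refine eq_zero_of_forall_cos_eq_one hgcd hθ₀.2 fun t ht => ?_
    have h1 := (Finset.sum_eq_zero_iff_of_nonneg hnn).1 h0 t ht
    have h2 : (t : ℝ) ≠ 0 := by exact_mod_cast (hT t ht).ne'
    rw [div_eq_zero_iff, or_iff_left h2] at h1
    linarith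
  rw [this] at hθ₀
  simp only [Set.mem_ofPred_eq, abs_zero] at hθ₀
  linarith [hθ₀.1]

theorem norm_exp_saddleExponent (c : ℝ) (T : Finset ℕ) (r θ : ℝ) :
    ‖Complex.exp (saddleExponent c T r θ)‖
      = Real.exp (-(c * ∑ t ∈ T, r ^ t * ((1 - Real.cos (t * θ)) / t))) := by
  rw [Complex.norm_exp]
  congr 1
  rw [saddleExponent, Complex.re_sum, Finset.mul_sum, ← Finset.sum_neg_distrib]
  refine Finset.sum_congr rfl fun t _ => ?_
  rw [Complex.re_ofReal_mul, mul_comm Complex.I, Complex.sub_re, Complex.sub_re,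
    Complex.exp_ofReal_mul_I_re]
  simp
  ring

/-- For `|θ| ≤ π / M` the term `t = M` alone gives Gaussian decay. Elsewhere the gcd condition and
compactness give decay `exp (-c δ r)`, which beats any power of `r`. The common bound is integrable
after rescaling. -/
theorem exists_norm_exp_saddleExponent_le {c : ℝ} (hc : 0 < c) {T : Finset ℕ}
    (hT : ∀ t ∈ T, 0 < t) (hgcd : T.gcd id = 1) {M : ℕ} (hM : IsGreatest (T : Set ℕ) M) :
    ∃ C : ℝ, ∀ r θ : ℝ, 1 ≤ r → |θ| ≤ Real.pi →
      ‖Complex.exp (saddleExponent c T r θ)‖ ≤ C * (1 + r ^ M * θ ^ 2)⁻¹ := by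
  have hM0 : 0 < M := hT M hM.1
  have hM1 : (1 : ℝ) ≤ M := by exact_mod_cast hM0
  have hπ := Real.pi_pos
  obtain ⟨δ, hδ, hδ'⟩ := exists_pos_le_sum_one_sub_cos hT hgcd (ε := Real.pi / M) (by positivity)
    (div_le_self hπ.le hM1)
  have hnn : ∀ (t : ℕ) (θ : ℝ), 0 ≤ (1 - Real.cos (t * θ)) / (t : ℝ) := fun t θ =>
    div_nonneg (sub_nonneg.2 (Real.cos_le_one _)) (Nat.cast_nonneg t)
  -- From `cos x ≤ 1 - 2 / π ^ 2 * x ^ 2` on `|x| ≤ π`, at `x = M * θ`.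
  set a : ℝ := c * (2 / Real.pi ^ 2 * M) with ha
  have ha0 : 0 < a := by positivity
  set C₁ : ℝ := 1 + 1 / a
  set C₂ : ℝ := M.factorial / (c * δ) ^ M * (1 + Real.pi ^ 2)
  refine ⟨max C₁ C₂, fun r θ hr hθ => ?_⟩
  have hr0 : 0 < r := one_pos.trans_le hr
  set y : ℝ := r ^ M * θ ^ 2 with hy
  have hy0 : 0 ≤ y := by positivity
  rw [norm_exp_saddleExponent]
  rcases le_total |θ| (Real.pi / M) with hsmall | hlarge
  · have h1 : a * y ≤ c * ∑ t ∈ T, r ^ t * ((1 - Real.cos (t * θ)) / t) := by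
      rw [ha, mul_assoc]
      refine mul_le_mul_of_nonneg_left ?_ hc.le
      refine le_trans ?_ (Finset.single_le_sum (f := fun t : ℕ =>
        r ^ t * ((1 - Real.cos (t * θ)) / t))
        (fun t _ => mul_nonneg (by positivity) (hnn t θ)) hM.1)
      have hcos := Real.cos_le_one_sub_mul_cos_sq (x := M * θ) (by
        rw [abs_mul, Nat.abs_cast]
        calc (M : ℝ) * |θ| ≤ M * (Real.pi / M) := by gcongr
          _ = Real.pi := by field_simp)
      calc 2 / Real.pi ^ 2 * M * y = r ^ M * ((2 / Real.pi ^ 2 * (M * θ) ^ 2) / M) := by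
            rw [hy]; field_simp
        _ ≤ _ := by gcongr; linarith
    calc Real.exp (-(c * ∑ t ∈ T, r ^ t * ((1 - Real.cos (t * θ)) / t)))
        ≤ Real.exp (-(a * y)) := by gcongr
      _ = (Real.exp (a * y))⁻¹ := Real.exp_neg _
      _ ≤ (1 + a * y)⁻¹ := by
        gcongr
        linarith [Real.add_one_le_exp (a * y)]
      _ ≤ C₁ * (1 + y)⁻¹ := by
        have : 1 + y ≤ C₁ * (1 + a * y) := by
          have : C₁ * (1 + a * y) = 1 + y + (a * y + 1 / a) := by
            simp only [C₁]
            field_simp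
            ring
          have : 0 ≤ a * y + 1 / a := by positivity
          linarith
        rw [inv_le_iff_one_le_mul₀ (by positivity), mul_right_comm, ← div_eq_mul_inv,
          one_le_div (by positivity)]
        exact this
      _ ≤ max C₁ C₂ * (1 + y)⁻¹ := by
        gcongr
        exact le_max_left _ _
  · have h1 : c * δ * r ≤ c * ∑ t ∈ T, r ^ t * ((1 - Real.cos (t * θ)) / t) := by
      rw [mul_assoc]
      refine mul_le_mul_of_nonneg_left ?_ hc.le
      calc δ * r ≤ (∑ t ∈ T, (1 - Real.cos (t * θ)) / t) * r := by
            gcongr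
            exact hδ' θ hlarge hθ
        _ ≤ _ := by
            rw [Finset.sum_mul]
            refine Finset.sum_le_sum fun t ht => ?_
            rw [mul_comm]
            refine mul_le_mul_of_nonneg_right ?_ (hnn t θ)
            exact le_self_pow₀ hr (hT t ht).ne'
    have hpos : 0 < (c * δ * r) ^ M := by positivity
    calc Real.exp (-(c * ∑ t ∈ T, r ^ t * ((1 - Real.cos (t * θ)) / t)))
        ≤ Real.exp (-(c * δ * r)) := by gcongr
      _ = (Real.exp (c * δ * r))⁻¹ := Real.exp_neg _
      _ ≤ ((c * δ * r) ^ M / M.factorial)⁻¹ := by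
        gcongr
        exact Real.pow_div_factorial_le_exp _ (by positivity) M
      _ ≤ C₂ * (1 + y)⁻¹ := by
        have hyle : 1 + y ≤ (1 + Real.pi ^ 2) * r ^ M := by
          have h2 : 1 ≤ r ^ M := one_le_pow₀ hr
          have h3 : θ ^ 2 ≤ Real.pi ^ 2 := sq_le_sq' (abs_le.1 hθ).1 (abs_le.1 hθ).2
          nlinarith
        rw [← div_eq_mul_inv, le_div_iff₀ (by positivity), inv_div, mul_pow]
        calc (M.factorial : ℝ) / ((c * δ) ^ M * r ^ M) * (1 + y)
            ≤ (M.factorial : ℝ) / ((c * δ) ^ M * r ^ M) * ((1 + Real.pi ^ 2) * r ^ M) := by gcongr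
          _ = C₂ := by
            simp only [C₂]
            field_simp
      _ ≤ max C₁ C₂ * (1 + y)⁻¹ := by
        gcongr
        exact le_max_right _ _

/-! ### The limit of the saddle point integral and the coefficient ratio -/

theorem tendsto_saddle_integral {c : ℝ} (hc : 0 < c) {T : Finset ℕ}
    (hT : ∀ t ∈ T, 0 < t) (hgcd : T.gcd id = 1) {M : ℕ} (hM : IsGreatest (T : Set ℕ) M) (k : ℕ) :
    Tendsto (fun ρ : ℝ => ((ρ ^ M : ℝ) : ℂ) * ∫ θ in (-Real.pi)..Real.pi,
        Complex.exp (saddleExponent c T (ρ ^ 2) θ) * Complex.exp (Complex.I * (k * θ : ℝ)))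
      atTop (𝓝 ((Real.sqrt (Real.pi / (c * M / 2)) : ℝ) : ℂ)) := by
  obtain ⟨C, hC⟩ := exists_norm_exp_saddleExponent_le hc hT hgcd hM
  have hM0 : 0 < M := hT M hM.1
  have hπ := Real.pi_pos
  set F : ℝ → ℝ → ℂ := fun ρ θ =>
    Complex.exp (saddleExponent c T (ρ ^ 2) θ) * Complex.exp (Complex.I * (k * θ : ℝ)) with hF
  have hFc : ∀ ρ, Continuous (F ρ) := fun ρ => by
    have := continuous_saddleExponent c T (ρ ^ 2)
    simp only [hF]
    fun_prop
  -- The integrand after `θ = u / ρ ^ M`, extended by zero to the whole line for dominated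
  -- convergence.
  set G : ℝ → ℝ → ℂ := fun ρ =>
    (Set.Ioc (-Real.pi * ρ ^ M) (Real.pi * ρ ^ M)).indicator fun u => F ρ (u / ρ ^ M) with hG
  have hint : ∀ᶠ ρ : ℝ in atTop,
      ∫ u, G ρ u = ((ρ ^ M : ℝ) : ℂ) * ∫ θ in (-Real.pi)..Real.pi, F ρ θ := by
    filter_upwards [eventually_ge_atTop 1] with ρ hρ
    have hρM : 0 < ρ ^ M := by positivity
    rw [hG, MeasureTheory.integral_indicator measurableSet_Ioc,
      ← intervalIntegral.integral_of_le (by nlinarith), intervalIntegral.integral_comp_div _ hρM.ne',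
      mul_div_cancel_right₀ _ hρM.ne', mul_div_cancel_right₀ _ hρM.ne', Complex.real_smul]
  refine Tendsto.congr' hint ?_
  have hgauss : ((Real.sqrt (Real.pi / (c * M / 2)) : ℝ) : ℂ)
      = ∫ u : ℝ, ((Real.exp (-(c * M / 2) * u ^ 2) : ℝ) : ℂ) := by
    rw [integral_complex_ofReal, integral_gaussian]
  rw [hgauss]
  refine MeasureTheory.tendsto_integral_filter_of_dominated_convergence
    (fun u => C * (1 + u ^ 2)⁻¹) ?_ ?_ (integrable_inv_one_add_sq.const_mul C) ?_
  · refine Eventually.of_forall fun ρ => ?_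
    exact ((hFc ρ).comp (continuous_id.div_const _)).aestronglyMeasurable.indicator
      measurableSet_Ioc
  · filter_upwards [eventually_ge_atTop 1] with ρ hρ
    refine Eventually.of_forall fun u => ?_
    have hρM : 0 < ρ ^ M := by positivity
    have hC0 : 0 ≤ C := by
      have := (norm_nonneg _).trans (hC 1 0 le_rfl (by simpa using hπ.le))
      simpa using this
    simp only [hG, Set.indicator_apply]
    split_ifs with hu
    · simp only [hF]
      rw [norm_mul, Complex.norm_exp_I_mul_ofReal, mul_one]
      refine (hC (ρ ^ 2) (u / ρ ^ M) (one_le_pow₀ hρ) ?_).trans_eq ?_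
      · rw [abs_le, le_div_iff₀ hρM, div_le_iff₀ hρM]
        exact ⟨hu.1.le, hu.2⟩
      · congr 3
        field_simp
        ring
    · rw [norm_zero]
      positivity
  · refine Eventually.of_forall fun u => ?_
    have hin : ∀ᶠ ρ : ℝ in atTop, G ρ u = F ρ (u / ρ ^ M) := by
      have hpow : Tendsto (fun ρ : ℝ => Real.pi * ρ ^ M) atTop atTop :=
        (tendsto_pow_atTop hM0.ne').const_mul_atTop hπ
      filter_upwards [hpow.eventually_gt_atTop |u|] with ρ hρ
      have := abs_lt.1 hρ
      exact Set.indicator_of_mem (Set.mem_Ioc.2 ⟨by linarith [this.1], this.2.le⟩) _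
    rw [tendsto_congr' hin]
    have h1 := (tendsto_saddleExponent (c := c) hT hM u).cexp
    have hθ : Tendsto (fun ρ : ℝ => u / ρ ^ M) atTop (𝓝 0) :=
      tendsto_const_nhds.div_atTop (tendsto_pow_atTop hM0.ne')
    have h2 : Tendsto (fun ρ : ℝ => Complex.exp (Complex.I * (k * (u / ρ ^ M) : ℝ))) atTop
        (𝓝 1) := by
      have hcont : Continuous fun θ : ℝ => Complex.exp (Complex.I * (k * θ : ℝ)) := by fun_prop
      have := (hcont.tendsto 0).comp hθ
      simpa [Function.comp_def] using this
    have h3 := h1.mul h2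
    rw [mul_one, ← Complex.ofReal_exp] at h3
    exact h3

theorem exists_saddle_points {c : ℝ} (hc : 0 < c) {T : Finset ℕ} (hT : ∀ t ∈ T, 0 < t)
    (hne : T.Nonempty) :
    ∃ ρ : ℕ → ℝ, (∀ n : ℕ, c * ∑ t ∈ T, (ρ n ^ 2) ^ t = n) ∧ Tendsto ρ atTop atTop := by
  obtain ⟨t₀, ht₀⟩ := hne
  have hcont : Continuous fun ρ : ℝ => c * ∑ t ∈ T, (ρ ^ 2) ^ t := by fun_prop
  have hex : ∀ n : ℕ, ∃ ρ : ℝ, 0 ≤ ρ ∧ c * ∑ t ∈ T, (ρ ^ 2) ^ t = n := by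
    intro n
    have hmem : (n : ℝ) ∈ Set.range fun ρ : ℝ => c * ∑ t ∈ T, (ρ ^ 2) ^ t := by
      -- Since `1 + n / c ≥ 1`, its positive powers are at least itself, so one term of the sum
      -- already exceeds `n / c`.
      refine mem_range_of_exists_le_of_exists_ge hcont ⟨0, ?_⟩ ⟨1 + n / c, ?_⟩
      · rw [Finset.sum_eq_zero fun t ht => by
          rw [zero_pow two_ne_zero, zero_pow (hT t ht).ne'], mul_zero]
        positivity
      · have h1 : 1 ≤ 1 + n / c := by
          have : 0 ≤ n / c := by positivity
          linarith
        calc (n : ℝ) = c * (n / c) := by field_simp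
          _ ≤ c * (1 + n / c) := by gcongr; linarith
          _ ≤ c * ((1 + n / c) ^ 2) ^ t₀ := by
            gcongr
            rw [← pow_mul]
            exact le_self_pow₀ h1 (by have := hT t₀ ht₀; omega)
          _ ≤ _ := by
            gcongr
            exact Finset.single_le_sum (f := fun t => ((1 + n / c) ^ 2) ^ t)
              (fun t _ => by positivity) ht₀
    obtain ⟨ρ, hρ⟩ := hmem
    exact ⟨|ρ|, abs_nonneg ρ, by simpa using hρ⟩
  choose ρ hρ0 hρ using hex
  refine ⟨ρ, hρ, tendsto_atTop.2 fun B => ?_⟩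
  filter_upwards [tendsto_natCast_atTop_atTop.eventually_gt_atTop (c * ∑ t ∈ T, (B ^ 2) ^ t)]
    with n hn
  by_contra! hlt
  rw [← hρ n] at hn
  refine hn.not_ge ?_
  have := hρ0 n
  gcongr

/-- The top power `r ^ M` dominates the saddle point equation. -/
theorem tendsto_div_pow_saddle_point {c : ℝ} (hc : 0 < c) {T : Finset ℕ} {M : ℕ}
    (hM : IsGreatest (T : Set ℕ) M) {ρ : ℕ → ℝ}
    (hρ : ∀ n : ℕ, c * ∑ t ∈ T, (ρ n ^ 2) ^ t = n) (hρtop : Tendsto ρ atTop atTop) :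
    Tendsto (fun n : ℕ => n / c / (ρ n ^ 2) ^ M) atTop (𝓝 1) := by
  have h1 : Tendsto (fun n => ∑ t ∈ T, 1 / ρ n ^ (2 * (M - t))) atTop
      (𝓝 (∑ t ∈ T, if t = M then 1 else 0)) := by
    refine tendsto_finsetSum _ fun t ht => ?_
    split_ifs with h
    · subst h
      simp
    · refine tendsto_const_nhds.div_atTop ((tendsto_pow_atTop ?_).comp hρtop)
      have := hM.2 ht
      omega
  rw [Finset.sum_ite_eq', if_pos (Finset.mem_coe.1 hM.1)] at h1
  refine h1.congr' ?_
  filter_upwards [hρtop.eventually_gt_atTop 0] with n hn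
  rw [← hρ n, mul_div_cancel_left₀ _ hc.ne', Finset.sum_div]
  refine Finset.sum_congr rfl fun t ht => ?_
  obtain ⟨e, rfl⟩ := Nat.exists_eq_add_of_le (hM.2 ht)
  rw [Nat.add_sub_cancel_left]
  field_simp
  ring

theorem coeff_ratio_asymptotics {c : ℝ} (hc : 0 < c) {T : Finset ℕ}
    (hT : ∀ t ∈ T, 0 < t) (hgcd : T.gcd id = 1) {M : ℕ} (hM : IsGreatest (T : Set ℕ) M)
    {b : ℕ → ℝ} (hb0 : b 0 = 1)
    (hb : ∀ n : ℕ, n * b n = c * ∑ t ∈ T, if t ≤ n then b (n - t) else 0) :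
    (∀ᶠ n in atTop, 0 < b n) ∧
      ∀ k : ℕ, Tendsto (fun n : ℕ => b (n - k) / b n / (n / c) ^ ((k : ℝ) / M)) atTop (𝓝 1) := by
  have hM0 : 0 < M := hT M hM.1
  obtain ⟨ρ, hρ, hρtop⟩ := exists_saddle_points hc hT ⟨M, hM.1⟩
  -- The factor independent of `k`, which cancels in the ratio.
  set A : ℕ → ℝ := fun n => ρ n ^ M * (2 * Real.pi *
    Real.exp (-(c * ∑ t ∈ T, (ρ n ^ 2) ^ t / t))) with hA
  set L : ℝ := Real.sqrt (Real.pi / (c * M / 2)) with hL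
  have hL0 : 0 < L := by positivity
  have hlim : ∀ k : ℕ, Tendsto (fun n => A n * (ρ n ^ 2) ^ (n - k) * b (n - k)) atTop (𝓝 L) := by
    intro k
    rw [← Filter.tendsto_ofReal_iff]
    refine ((tendsto_saddle_integral hc hT hgcd hM k).comp hρtop).congr' ?_
    filter_upwards [hρtop.eventually_gt_atTop 0, eventually_ge_atTop k] with n hn hkn
    simp only [Function.comp_apply]
    rw [coeff_eq_saddle_integral c hT hb0 hb (by positivity) hkn (hρ n), hA, ← Complex.ofReal_mul]
    congr 1
    ring
  have hApos : ∀ᶠ n in atTop, 0 < ρ n ∧ 0 < A n := by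
    filter_upwards [hρtop.eventually_gt_atTop 0] with n hn
    exact ⟨hn, by positivity⟩
  -- Positivity comes from the nonzero limit `L`; this is also what yields existence of
  -- `S`-permutations.
  have hpos : ∀ᶠ n in atTop, 0 < b n := by
    filter_upwards [(hlim 0).eventually (lt_mem_nhds hL0), hApos] with n h1 h2
    obtain ⟨h2, h3⟩ := h2
    rw [Nat.sub_zero] at h1
    exact pos_of_mul_pos_right h1 (by positivity)
  refine ⟨hpos, fun k => ?_⟩
  have hratio := (hlim k).div (hlim 0) hL0.ne'
  rw [div_self hL0.ne'] at hratio
  have hroot := ((tendsto_div_pow_saddle_point hc hM hρ hρtop).rpow_const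
    (p := (k : ℝ) / M) (Or.inl one_ne_zero))
  rw [Real.one_rpow] at hroot
  have h := hratio.div hroot one_ne_zero
  rw [div_one] at h
  refine h.congr' ?_
  filter_upwards [hApos, hpos, eventually_ge_atTop k, eventually_gt_atTop 0] with n hn hbn hkn hn0
  obtain ⟨hn, hAn⟩ := hn
  have hr : 0 < ρ n ^ 2 := by positivity
  have hMk : ((ρ n ^ 2) ^ M) ^ ((k : ℝ) / M) = (ρ n ^ 2) ^ k := by
    rw [← Real.rpow_natCast _ M, ← Real.rpow_mul hr.le, ← Real.rpow_natCast _ k]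
    congr 1
    have : (M : ℝ) ≠ 0 := by exact_mod_cast hM0.ne'
    field_simp
  have hnc : 0 < (n : ℝ) / c := by
    have : (0 : ℝ) < n := by exact_mod_cast hn0
    positivity
  have hnc' : (n / c : ℝ) ^ ((k : ℝ) / M) ≠ 0 := (Real.rpow_pos_of_pos hnc _).ne'
  have hsplit : (ρ n ^ 2) ^ n = (ρ n ^ 2) ^ (n - k) * (ρ n ^ 2) ^ k := by
    rw [← pow_add, Nat.sub_add_cancel hkn]
  simp only [Pi.div_apply]
  rw [Real.div_rpow hnc.le (by positivity), hMk, Nat.sub_zero, hsplit]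
  field_simp

/-! ### Reduction to gcd one and conclusion -/

theorem expectedNumCycles_ratio_on_multiples (S : Finset ℕ) (hS : ∀ s ∈ S, 0 < s) (m : ℕ)
    (hm : IsGreatest (S : Set ℕ) m) (k : ℕ) (hk : k ∈ S) :
    (∀ᶠ j : ℕ in atTop, (sPermutations S (S.gcd id * j)).Nonempty) ∧
      Tendsto (fun j : ℕ => expectedNumCycles S k (S.gcd id * j) /
        (((S.gcd id * j : ℕ) : ℝ) ^ ((k : ℝ) / m) / k)) atTop (𝓝 1) := by
  set d := S.gcd id with hd
  have hdvd : ∀ s ∈ S, d ∣ s := fun s hs => Finset.gcd_dvd hs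
  have hd0 : 0 < d := Nat.pos_of_dvd_of_pos (hdvd k hk) (hS k hk)
  have hdR : (d : ℝ) ≠ 0 := by exact_mod_cast hd0.ne'
  have hkR : (k : ℝ) ≠ 0 := by exact_mod_cast (hS k hk).ne'
  have hcond : ∀ t ∈ S.image (· / d), 0 < t := by
    intro t ht
    obtain ⟨s, hs, rfl⟩ := Finset.mem_image.1 ht
    exact Nat.div_pos (Nat.le_of_dvd (hS s hs) (hdvd s hs)) hd0
  have hgcd : (S.image (· / d)).gcd id = 1 := by
    rw [Finset.gcd_image]
    exact Finset.gcd_div_id_eq_one hk (hS k hk).ne'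
  have hM : IsGreatest (S.image (· / d) : Set ℕ) (m / d) := by
    refine ⟨Finset.mem_coe.2 (Finset.mem_image_of_mem _ hm.1), fun t ht => ?_⟩
    obtain ⟨s, hs, rfl⟩ := Finset.mem_image.1 (Finset.mem_coe.1 ht)
    exact Nat.div_le_div_right (hm.2 hs)
  have hinj : Set.InjOn (· / d) (S : Set ℕ) := fun s hs s' hs' h => by
    rw [← Nat.mul_div_cancel' (hdvd s hs), ← Nat.mul_div_cancel' (hdvd s' hs')]
    exact congrArg (d * ·) h
  have hsub : ∀ s ∈ S, ∀ j, d * (j - s / d) = d * j - s := fun s hs j => by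
    rw [Nat.mul_sub, Nat.mul_div_cancel' (hdvd s hs)]
  have hrec : ∀ j : ℕ, j * sPermutationDensity S (d * j) = 1 / (d : ℝ) *
      ∑ t ∈ S.image (· / d), if t ≤ j then sPermutationDensity S (d * (j - t)) else 0 := by
    intro j
    have h := sPermutationDensity_recurrence hS (d * j)
    rw [Finset.sum_image hinj]
    have hcongr : ∀ s ∈ S, (if s / d ≤ j then sPermutationDensity S (d * (j - s / d)) else 0)
        = if s ≤ d * j then sPermutationDensity S (d * j - s) else 0 := by
      intro s hs
      rw [hsub s hs]
      have : s / d ≤ j ↔ s ≤ d * j := by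
        conv_rhs => rw [← Nat.mul_div_cancel' (hdvd s hs)]
        exact (Nat.mul_le_mul_left_iff hd0).symm
      simp only [this]
    rw [Finset.sum_congr rfl hcongr, ← h]
    push_cast
    field_simp
  -- With `c = 1 / d`, `j / c` is `d * j`, and the exponent `(k / d) / (m / d)` is `k / m`.
  obtain ⟨hpos, hlim⟩ := coeff_ratio_asymptotics (c := 1 / (d : ℝ)) (by positivity) hcond hgcd hM
    (b := fun j => sPermutationDensity S (d * j)) (sPermutationDensity_zero S) hrec
  refine ⟨hpos.mono fun j hj => sPermutationDensity_pos_iff.1 hj, ?_⟩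
  refine (hlim (k / d)).congr' ?_
  filter_upwards [eventually_ge_atTop k] with j hj
  have hkj : k ≤ d * j := hj.trans (Nat.le_mul_of_pos_left j hd0)
  rw [expectedNumCycles_eq hS hk hkj, hsub k hk, Nat.cast_div (hdvd k hk) hdR,
    Nat.cast_div (hdvd m hm.1) hdR, div_div_div_cancel_right₀ hdR,
    div_div_div_cancel_right₀ hkR]
  congr 2
  push_cast
  field_simp

theorem mainTheorem8 (S : Finset ℕ) (hS : ∀ s ∈ S, 0 < s) (m : ℕ)
    (hm : IsGreatest (S : Set ℕ) m) (k : ℕ) (hk : k ∈ S) :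
    (fun n : ℕ => expectedNumCycles S k n)
        ~[atTop ⊓ 𝓟 {n : ℕ | (sPermutations S n).Nonempty}]
        (fun n : ℕ => (n : ℝ) ^ ((k : ℝ) / (m : ℝ)) / (k : ℝ)) ∧
      (∃ᶠ n : ℕ in atTop, (sPermutations S n).Nonempty) ∧
      (S.gcd id = 1 →
        (∀ᶠ n : ℕ in atTop, (sPermutations S n).Nonempty) ∧
        (fun n : ℕ => expectedNumCycles S k n)
          ~[atTop] (fun n : ℕ => (n : ℝ) ^ ((k : ℝ) / (m : ℝ)) / (k : ℝ))) := by
  obtain ⟨hne, hlim⟩ := expectedNumCycles_ratio_on_multiples S hS m hm k hk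
  have hd0 : 0 < S.gcd id :=
    Nat.pos_of_dvd_of_pos (Finset.gcd_dvd (f := id) hk) (hS k hk)
  have hequiv : (fun n : ℕ => expectedNumCycles S k n)
      ~[atTop ⊓ 𝓟 {n : ℕ | (sPermutations S n).Nonempty}]
      (fun n : ℕ => (n : ℝ) ^ ((k : ℝ) / (m : ℝ)) / (k : ℝ)) := by
    refine (isEquivalent_iff_tendsto_one ?_).2 ?_
    · refine Eventually.filter_mono inf_le_left ?_
      filter_upwards [eventually_gt_atTop 0] with n hn
      have hn : (0 : ℝ) < n := by exact_mod_cast hn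
      have hk : (0 : ℝ) < k := by exact_mod_cast hS k hk
      exact (div_pos (Real.rpow_pos_of_pos hn _) hk).ne'
    -- Every admissible `n` is a multiple of the gcd, so the limit along `j = n / gcd` covers all of
    -- them.
    · refine ((hlim.comp (Nat.tendsto_div_const_atTop hd0.ne')).mono_left inf_le_left).congr' ?_
      filter_upwards [mem_inf_of_right (mem_principal_self _)] with n hn
      simp only [Function.comp_apply, Pi.div_apply,
        Nat.mul_div_cancel' (gcd_dvd_of_sPermutations_nonempty hn)]
  refine ⟨hequiv, ?_, fun hgcd => ?_⟩
  · exact (tendsto_id.const_mul_atTop' hd0).frequently hne.frequently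
  · have hev : ∀ᶠ n : ℕ in atTop, (sPermutations S n).Nonempty := by
      filter_upwards [hne] with n hn
      rwa [hgcd, one_mul] at hn
    exact ⟨hev, by rwa [inf_eq_left.2 (le_principal_iff.2 hev)] at hequiv⟩
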